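/- Let $F:\mathbb{R}\to[0,1]$ satisfy $F(t)=1-F(-t)$ for all $t$, and suppose that $F$ is strictly increasing, twice differentiable, and strongly log-concave, i.e. $\log F$ is $\gamma$-strongly concave on $[-2,2]$ for some $\gamma>0$. For $n\ge 2$ let $\mathcal{W}_n=\{w\in\mathbb{R}^n : \sum_i w_i=0,\ \|w\|_\infty\le 1\}$; for $w \in \mathcal{W}_n$ let $M(w)$ be the $n\times n$ matrix with entries $M(w)_{ij}=F(w_i-w_j)$, and let $\mathbb{C}_{\mathrm{PAR}}(F)=\{M(w): w\in\mathcal{W}_n\}$. Given $M^*\in\mathbb{C}_{\mathrm{PAR}}(F)$, one observes $Y\in\{0,1\}^{n\times n}$ whose entries $Y_{ij}$, $i\le j$, are independent with $\mathbb{P}[Y_{ij}=1]=M^*_{ij}$, and $Y_{ji}=1-Y_{ij}$ for $i<j$. Then there is a constant $c_\ell>0$, depending only on $F$, such that for every $n\ge2$ $$\inf_{\widetilde M}\ \sup_{M^*\in\mathbb{C}_{\mathrm{PAR}}(F)}\frac1{n^2}\,\mathbb{E}\big[\|\widetilde M-M^*\|_F^2\big]\ \ge\ \frac{c_\ell}{n},$$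 where the infimum is over all measurable functions $Y\mapsto\widetilde M(Y)\in[0,1]^{n\times n}$ and $\|\cdot\|_F$ is the Frobenius norm. Conversely, there is a constant $c_u\ge c_\ell$, depending only on $F$, such that for every $n\ge 2$ the maximum likelihood estimate $\widehat w_{\mathrm{ML}}$, i.e. the maximizer over $w\in\mathcal{W}_n$ of $$\prod_{i<j}F(w_i-w_j)^{Y_{ij}}\big(1-F(w_i-w_j)\big)^{1-Y_{ij}},$$ exists and is unique for every $Y$, and the matrix it induces satisfies $$\sup_{M^*\in\mathbb{C}_{\mathrm{PAR}}(F)}\frac1{n^2}\,\mathbb{E}\big[\|M(\widehat w_{\mathrm{ML}})-M^*\|_F^2\big]\ \le\ \frac{c_u}{n}.$$ -/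

import Mathlib

open MeasureTheory
open scoped ENNReal

noncomputable section

/-- A valid link function: non-decreasing `F : ℝ → [0,1]` with `F t = 1 - F (-t)`. -/
structure IsValidLink (F : ℝ → ℝ) : Prop where
  monotone : Monotone F
  mem_Icc : ∀ t, F t ∈ Set.Icc (0 : ℝ) 1
  symm : ∀ t, F t = 1 - F (-t)

/-- Strong log-concavity on `[-2, 2]`, the range of the differences of admissible weights.
(No increasing function with values in `[0,1]` is strongly log-concave on all of `ℝ`.) -/
def IsStronglyLogConcave (F : ℝ → ℝ) : Prop :=
  ∃ γ : ℝ, 0 < γ ∧ StrongConcaveOn (Set.Icc (-2 : ℝ) 2) γ (fun t => Real.log (F t))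

/-- `F` is twice differentiable on `ℝ`. -/
def IsTwiceDifferentiable (F : ℝ → ℝ) : Prop :=
  Differentiable ℝ F ∧ Differentiable ℝ (deriv F)

/-- The admissible weight vectors: `⟨w, 1⟩ = 0` and `‖w‖_∞ ≤ 1`. -/
def weightSet (n : ℕ) : Set (Fin n → ℝ) :=
  {w | ∑ i, w i = 0 ∧ ∀ i, |w i| ≤ 1}

/-- The pairwise-comparison matrix `M(w)` induced by the weights `w` through `F`. -/
def inducedMatrix (F : ℝ → ℝ) {n : ℕ} (w : Fin n → ℝ) : Matrix (Fin n) (Fin n) ℝ :=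
  Matrix.of fun i j => F (w i - w j)

/-- The parametric class of matrices induced by admissible weight vectors. -/
def parametricClass (F : ℝ → ℝ) (n : ℕ) : Set (Matrix (Fin n) (Fin n) ℝ) :=
  {M | ∃ w ∈ weightSet n, M = inducedMatrix F w}

/-- Observed comparison matrices; the entry `(i, j)` is `true` if `i` beats `j`. -/
abbrev Observation (n : ℕ) : Type := Fin n → Fin n → Bool

/-- The Bernoulli distribution on `Bool` with `P[true] = p`, for `p ∈ [0,1]`. -/
def bernoulliLaw (p : ℝ) : Measure Bool :=
  ENNReal.ofReal p • Measure.dirac true + ENNReal.ofReal (1 - p) • Measure.dirac false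

instance (p : ℝ) : IsFiniteMeasure (bernoulliLaw p) := by
  constructor
  simp [bernoulliLaw, ENNReal.add_lt_top]

/-- Completes the entries with `i ≤ j` to a full matrix by `Y j i = 1 - Y i j` for `i < j`. -/
def completeObservation {n : ℕ} (Z : {p : Fin n × Fin n // p.1 ≤ p.2} → Bool) :
    Observation n :=
  fun i j => if h : i ≤ j then Z ⟨(i, j), h⟩ else !(Z ⟨(j, i), (not_le.mp h).le⟩)

/-- The law of the data `Y` when the comparison probabilities are `M`: the entries with `i ≤ j`
are independent with `P[Y i j = 1] = M i j`, and `Y j i = 1 - Y i j` for `i < j`. -/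
def observationLaw {n : ℕ} (M : Matrix (Fin n) (Fin n) ℝ) : Measure (Observation n) :=
  (Measure.pi fun p : {p : Fin n × Fin n // p.1 ≤ p.2} =>
    bernoulliLaw (M p.1.1 p.1.2)).map completeObservation

/-- The squared Frobenius norm. -/
def frobeniusSq {n : ℕ} (A : Matrix (Fin n) (Fin n) ℝ) : ℝ :=
  ∑ i, ∑ j, A i j ^ 2

/-- The expected error `(1 / n²) E‖Mhat(Y) - M‖_F²` of the estimator `Mhat` when `Y` is drawn
from the model with matrix `M`. -/
def risk {n : ℕ} (Mhat : Observation n → Matrix (Fin n) (Fin n) ℝ)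
    (M : Matrix (Fin n) (Fin n) ℝ) : ℝ≥0∞ :=
  ∫⁻ Y, ENNReal.ofReal (1 / (n : ℝ) ^ 2 * frobeniusSq (Mhat Y - M)) ∂(observationLaw M)

/-- The minimax risk over a class `C`, the infimum being over all estimators with values in
`[0,1]^{n × n}` (the space of observations is finite and discrete, so every estimator is
measurable). -/
def minimaxRisk {n : ℕ} (C : Set (Matrix (Fin n) (Fin n) ℝ)) : ℝ≥0∞ :=
  ⨅ (Mhat : Observation n → Matrix (Fin n) (Fin n) ℝ)
    (_ : ∀ Y i j, Mhat Y i j ∈ Set.Icc (0 : ℝ) 1), ⨆ M ∈ C, risk Mhat M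

/-- The likelihood of the weights `w` given the outcomes of all comparisons `i < j`. -/
def likelihood (F : ℝ → ℝ) {n : ℕ} (Y : Observation n) (w : Fin n → ℝ) : ℝ :=
  ∏ i, ∏ j ∈ Finset.Ioi i, if Y i j then F (w i - w j) else 1 - F (w i - w j)

/-- `w` is a maximum likelihood estimate of the weights: it maximizes the likelihood over the
admissible weight vectors. -/
def IsMLE (F : ℝ → ℝ) {n : ℕ} (Y : Observation n) (w : Fin n → ℝ) : Prop :=
  w ∈ weightSet n ∧ IsMaxOn (likelihood F Y) (weightSet n) w

end

/-! ### Analytic properties of the link function -/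

/-! Upper bound. On mean-zero vectors the Laplacian of the complete graph is `n` times the identity,
so γ-strong concavity of `log F` makes the log-likelihood strongly concave with modulus `γ n`
(`log_likelihood_le`). This gives uniqueness of the maximizer; existence is compactness. As the
maximizer `v` does at least as well as the true `w`, the gradient term at `w` must pay for the
quadratic term, and Cauchy–Schwarz gives `‖v - w‖² ≤ 4 ‖score‖² / (γ n)²` (`IsMLE.sum_sub_sq_le`).
At the truth the score is a sum of independent, centred, bounded terms, so its second moment is
`O(n²)` and `E‖v - w‖² = O(1)`. Since `F` is Lipschitz on `[-2, 2]`, the squared Frobenius error is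
`O(n)`.

Lower bound. This is Assouad's argument on a cube of dimension `n / 2`: items are paired off and
each pair gets weights `±ε`, with `ε²` of order `1 / n`. Flipping one sign moves two weights by
`2ε`, which changes the law of the data by a bounded Hellinger distance (`one_eighth_le_sum_min`),
yet moves every off-diagonal entry of a row by order `ε`. So each of the `n / 2` rows costs order `n
ε²`, a constant, and the total error is of order `n`. -/

theorem IsValidLink.pos {F : ℝ → ℝ} (hF : IsValidLink F) (hmono : StrictMono F) (t : ℝ) :
    0 < F t :=
  (hF.mem_Icc (t - 1)).1.trans_lt (hmono (by linarith))

theorem IsValidLink.neg_eq {F : ℝ → ℝ} (hF : IsValidLink F) (t : ℝ) : F (-t) = 1 - F t := by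
  linarith [hF.symm t]

theorem IsValidLink.deriv_neg {F : ℝ → ℝ} (hF : IsValidLink F) (hd : Differentiable ℝ F)
    (t : ℝ) : deriv F (-t) = deriv F t := by
  have h1 : HasDerivAt (fun s => 1 - F (-s)) (deriv F (-t)) t := by
    have h := ((hd (-t)).hasDerivAt.comp t (hasDerivAt_neg t)).const_sub 1
    simpa [Function.comp_def] using h
  have h2 : (fun s => 1 - F (-s)) = F := funext fun s => (hF.symm s).symm
  rw [h2] at h1
  exact h1.deriv.symm

/-- The logarithmic derivative of the link function. -/
noncomputable def linkScore (F : ℝ → ℝ) (t : ℝ) : ℝ := deriv F t / F t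

theorem hasDerivAt_log_link {F : ℝ → ℝ} (hF : IsValidLink F) (hmono : StrictMono F)
    (hd : Differentiable ℝ F) (t : ℝ) :
    HasDerivAt (fun s => Real.log (F s)) (linkScore F t) t :=
  (hd t).hasDerivAt.log (hF.pos hmono t).ne'

theorem ConcaveOn.le_tangent {s : Set ℝ} {f : ℝ → ℝ} {f' x y : ℝ} (hf : ConcaveOn ℝ s f)
    (hx : x ∈ s) (hy : y ∈ s) (hd : HasDerivAt f f' x) : f y ≤ f x + f' * (y - x) := by
  rcases lt_trichotomy x y with h | rfl | h
  · have := hf.slope_le_of_hasDerivAt hx hy h hd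
    rw [slope_def_field, div_le_iff₀ (by linarith)] at this
    linarith
  · simp
  · have := hf.le_slope_of_hasDerivAt hy hx h hd
    rw [slope_def_field, le_div_iff₀ (by linarith)] at this
    linarith

theorem StrongConcaveOn.le_tangent {s : Set ℝ} {f : ℝ → ℝ} {m f' x y : ℝ}
    (hf : StrongConcaveOn s m f) (hx : x ∈ s) (hy : y ∈ s) (hd : HasDerivAt f f' x) :
    f y ≤ f x + f' * (y - x) - m / 2 * (y - x) ^ 2 := by
  rw [strongConcaveOn_iff_convex] at hf
  have hd' : HasDerivAt (fun t => f t + m / 2 * ‖t‖ ^ 2) (f' + m / 2 * (2 * x)) x := by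
    simp only [Real.norm_eq_abs, sq_abs]
    simpa using hd.fun_add (((hasDerivAt_id x).pow 2).const_mul (m / 2))
  have := hf.le_tangent hx hy hd'
  simp only [Real.norm_eq_abs, sq_abs] at this
  nlinarith

/-- The second derivative serves only to make `deriv F` continuous. The normalization `1 ≤ B` later
keeps the perturbation `ε` of the lower bound small. -/
theorem exists_linkScore_bound {F : ℝ → ℝ} (hF : IsValidLink F) (hmono : StrictMono F)
    (hdiff : IsTwiceDifferentiable F) :
    ∃ B : ℝ, 1 ≤ B ∧ ∀ t ∈ Set.Icc (-2 : ℝ) 2, |linkScore F t| ≤ B := by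
  have hc : Continuous (linkScore F) :=
    hdiff.2.continuous.div hdiff.1.continuous fun t => (hF.pos hmono t).ne'
  obtain ⟨B, hB⟩ := isCompact_Icc.exists_bound_of_continuousOn hc.continuousOn
  exact ⟨max B 1, le_max_right _ _, fun t ht => (hB t ht).trans (le_max_left _ _)⟩

theorem deriv_eq_link_mul_linkScore {F : ℝ → ℝ} (hF : IsValidLink F) (hmono : StrictMono F)
    (t : ℝ) : deriv F t = F t * linkScore F t := by
  have := (hF.pos hmono t).ne'
  unfold linkScore
  field_simp

/-- `F' = F · (log F)'` with `F ≤ 1`, so a bound on the score is a Lipschitz constant. -/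
theorem abs_link_sub_le {F : ℝ → ℝ} (hF : IsValidLink F) (hmono : StrictMono F)
    (hd : Differentiable ℝ F) {B : ℝ} (hB : ∀ t ∈ Set.Icc (-2 : ℝ) 2, |linkScore F t| ≤ B)
    {x y : ℝ} (hx : x ∈ Set.Icc (-2 : ℝ) 2) (hy : y ∈ Set.Icc (-2 : ℝ) 2) :
    |F x - F y| ≤ B * |x - y| := by
  refine Convex.norm_image_sub_le_of_norm_deriv_le (fun t _ => hd t) (fun t ht => ?_)
    (convex_Icc (-2 : ℝ) 2) hy hx
  rw [deriv_eq_link_mul_linkScore hF hmono, Real.norm_eq_abs, abs_mul,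
    abs_of_pos (hF.pos hmono t)]
  exact (mul_le_of_le_one_left (abs_nonneg _) (hF.mem_Icc t).2).trans (hB t ht)

/-- Strict monotonicity alone would allow `F' = 0`. Each `x` in `[-1, 1]` has room at least 1 to its
right inside `[-2, 2]`: comparing `log F x ≤ log F 2` with the strongly concave tangent bound at `x`
forces the score to be at least `γ / 2 * (2 - x) ≥ γ / 2`. -/
theorem exists_link_expansion {F : ℝ → ℝ} (hF : IsValidLink F) (hmono : StrictMono F)
    (hconc : IsStronglyLogConcave F) (hd : Differentiable ℝ F) :
    ∃ κ : ℝ, 0 < κ ∧ ∀ x ∈ Set.Icc (-1 : ℝ) 1, ∀ y ∈ Set.Icc (-1 : ℝ) 1,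
      κ * |x - y| ≤ |F x - F y| := by
  obtain ⟨γ, hγ, hc⟩ := hconc
  have hscore : ∀ x ∈ Set.Icc (-1 : ℝ) 1, γ / 2 ≤ linkScore F x := by
    intro x hx
    have h1 := hc.le_tangent (x := x) (y := 2) ⟨by linarith [hx.1], by linarith [hx.2]⟩
      (by norm_num) (hasDerivAt_log_link hF hmono hd x)
    have h2 : Real.log (F x) ≤ Real.log (F 2) :=
      Real.log_le_log (hF.pos hmono x) (hF.monotone (by linarith [hx.2]))
    have h3 : 0 ≤ (2 - x) * (linkScore F x - γ / 2 * (2 - x)) := by linarith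
    have h4 : 0 ≤ linkScore F x - γ / 2 * (2 - x) :=
      nonneg_of_mul_nonneg_right h3 (by linarith [hx.2])
    nlinarith [hx.2]
  have hp := hF.pos hmono (-1)
  refine ⟨F (-1) * (γ / 2), by positivity, ?_⟩
  have key : ∀ x ∈ Set.Icc (-1 : ℝ) 1, ∀ y ∈ Set.Icc (-1 : ℝ) 1, x ≤ y →
      F (-1) * (γ / 2) * (y - x) ≤ F y - F x := by
    intro x hx y hy hxy
    refine (convex_Icc (-1 : ℝ) 1).mul_sub_le_image_sub_of_le_deriv hd.continuous.continuousOn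
      hd.differentiableOn (fun t ht => ?_) x hx y hy hxy
    have ht' := interior_subset ht
    rw [deriv_eq_link_mul_linkScore hF hmono]
    exact mul_le_mul (hF.monotone ht'.1) (hscore t ht') (by positivity) (hF.pos hmono t).le
  intro x hx y hy
  rcases le_total x y with h | h
  · rw [abs_sub_comm x y, abs_sub_comm (F x), abs_of_nonneg (sub_nonneg.2 h),
      abs_of_nonneg (sub_nonneg.2 (hF.monotone h))]
    exact key x hx y hy h
  · rw [abs_of_nonneg (sub_nonneg.2 h), abs_of_nonneg (sub_nonneg.2 (hF.monotone h))]
    exact key y hy x hx h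

/-! ### Products of Bernoulli distributions -/

/-- The mass that the Bernoulli distribution with `P[true] = p` gives to `b`. -/
def bernoulliMass (p : ℝ) (b : Bool) : ℝ := if b then p else 1 - p

/-- The mass function of a product of Bernoulli distributions. -/
def bernoulliProd {ι : Type*} [Fintype ι] (q : ι → ℝ) (Z : ι → Bool) : ℝ :=
  ∏ i, bernoulliMass (q i) (Z i)

theorem bernoulliMass_nonneg {p : ℝ} (hp : p ∈ Set.Icc (0 : ℝ) 1) (b : Bool) :
    0 ≤ bernoulliMass p b := by
  cases b <;> simp [bernoulliMass, hp.1, hp.2]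

theorem bernoulliLaw_singleton (p : ℝ) (b : Bool) :
    bernoulliLaw p {b} = ENNReal.ofReal (bernoulliMass p b) := by
  cases b <;> simp [bernoulliLaw, bernoulliMass]

theorem bernoulliProd_nonneg {ι : Type*} [Fintype ι] {q : ι → ℝ}
    (hq : ∀ i, q i ∈ Set.Icc (0 : ℝ) 1) (Z : ι → Bool) :
    0 ≤ bernoulliProd q Z :=
  Finset.prod_nonneg fun i _ => bernoulliMass_nonneg (hq i) _

section BernoulliProd

variable {ι : Type*} [Fintype ι] [DecidableEq ι]

theorem sum_bernoulliProd_mul_prod (q : ι → ℝ) (g : ι → Bool → ℝ) :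
    ∑ Z : ι → Bool, bernoulliProd q Z * ∏ i, g i (Z i)
      = ∏ i, ∑ b, bernoulliMass (q i) b * g i b := by
  rw [Fintype.prod_sum]
  exact Finset.sum_congr rfl fun Z _ => by rw [bernoulliProd, Finset.prod_mul_distrib]

theorem sum_bernoulliProd (q : ι → ℝ) : ∑ Z : ι → Bool, bernoulliProd q Z = 1 := by
  have := sum_bernoulliProd_mul_prod q fun _ _ => 1
  simpa [bernoulliMass] using this

theorem sum_bernoulliProd_mul_mul_eq_zero (q : ι → ℝ) (h : ι → Bool → ℝ) {i j : ι} (hij : i ≠ j)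
    (h0 : ∑ b, bernoulliMass (q i) b * h i b = 0) :
    ∑ Z : ι → Bool, bernoulliProd q Z * (h i (Z i) * h j (Z j)) = 0 := by
  -- The two-factor product is written as a product over all coordinates, with factor 1 away from
  -- `i` and `j`, so that the expectation factorizes.
  have key := sum_bernoulliProd_mul_prod q fun k b =>
    (if k = i then h k b else 1) * (if k = j then h k b else 1)
  simp only [Finset.prod_mul_distrib, Finset.prod_ite_eq', Finset.mem_univ, if_true] at key
  rw [key]
  refine Finset.prod_eq_zero (Finset.mem_univ i) ?_
  simpa [hij] using h0

/-- The second moment of a linear combination of independent, centred and bounded variables. -/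
theorem sum_bernoulliProd_mul_sq_le {q : ι → ℝ} (hq : ∀ i, q i ∈ Set.Icc (0 : ℝ) 1)
    (h : ι → Bool → ℝ) (h0 : ∀ i, ∑ b, bernoulliMass (q i) b * h i b = 0) {B : ℝ}
    (hB : ∀ i b, |h i b| ≤ B) (s : ι → ℝ) :
    ∑ Z : ι → Bool, bernoulliProd q Z * (∑ i, s i * h i (Z i)) ^ 2 ≤ B ^ 2 * ∑ i, s i ^ 2 := by
  have expand : ∀ Z : ι → Bool, bernoulliProd q Z * (∑ i, s i * h i (Z i)) ^ 2
      = ∑ i, ∑ j, s i * s j * (bernoulliProd q Z * (h i (Z i) * h j (Z j))) := by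
    intro Z
    rw [sq, Finset.sum_mul_sum, Finset.mul_sum]
    refine Finset.sum_congr rfl fun i _ => ?_
    rw [Finset.mul_sum]
    exact Finset.sum_congr rfl fun j _ => by ring
  simp_rw [expand]
  rw [Finset.sum_comm, Finset.mul_sum]
  refine Finset.sum_le_sum fun i _ => ?_
  -- Independence and centring kill the cross terms; only `j = i` survives.
  rw [Finset.sum_comm, Finset.sum_eq_single i]
  · rw [← Finset.mul_sum, mul_comm, ← sq]
    refine mul_le_mul_of_nonneg_right ?_ (sq_nonneg _)
    calc ∑ Z : ι → Bool, bernoulliProd q Z * (h i (Z i) * h i (Z i))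
        ≤ ∑ Z : ι → Bool, bernoulliProd q Z * B ^ 2 := by
          refine Finset.sum_le_sum fun Z _ =>
            mul_le_mul_of_nonneg_left ?_ (bernoulliProd_nonneg hq Z)
          rw [← sq, ← sq_abs]
          exact pow_le_pow_left₀ (abs_nonneg _) (hB i _) 2
      _ = B ^ 2 := by rw [← Finset.sum_mul, sum_bernoulliProd, one_mul]
  · intro j _ hj
    rw [← Finset.mul_sum, sum_bernoulliProd_mul_mul_eq_zero q h hj.symm (h0 i), mul_zero]
  · simp

end BernoulliProd

/-! ### Affinity -/

theorem sq_sqrt_sub_sqrt_le {c x y : ℝ} (hc : 0 < c) (hx : c ≤ x) (hy : c ≤ y) :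
    (√x - √y) ^ 2 ≤ (x - y) ^ 2 / (4 * c) := by
  have hsx := Real.sq_sqrt (hc.le.trans hx)
  have hsy := Real.sq_sqrt (hc.le.trans hy)
  have hsc := Real.sq_sqrt hc.le
  have h1 : 2 * √c ≤ √x + √y := by
    linarith [Real.sqrt_le_sqrt hx, Real.sqrt_le_sqrt hy]
  have h2 : 4 * c ≤ (√x + √y) ^ 2 := by
    have := pow_le_pow_left₀ (by positivity) h1 2
    nlinarith
  rw [le_div_iff₀ (by positivity)]
  have h3 : x - y = (√x - √y) * (√x + √y) := by ring_nf; linarith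
  rw [h3, mul_pow]
  exact mul_le_mul_of_nonneg_left h2 (sq_nonneg _)

/-- The affinity is 1 minus half the squared Hellinger distance, to which each of the two outcomes
contributes at most `(p - q)² / (4c)`. -/
theorem one_sub_affinity_le {c p q : ℝ} (hc : 0 < c) (hp : p ∈ Set.Icc c (1 - c))
    (hq : q ∈ Set.Icc c (1 - c)) :
    1 - (p - q) ^ 2 / (4 * c)
      ≤ ∑ b, √(bernoulliMass p b) * √(bernoulliMass q b) := by
  have h1 := sq_sqrt_sub_sqrt_le hc hp.1 hq.1
  have h2 := sq_sqrt_sub_sqrt_le hc (x := 1 - p) (y := 1 - q) (by linarith [hp.2])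
    (by linarith [hq.2])
  have e : (1 - p - (1 - q)) ^ 2 = (p - q) ^ 2 := by ring
  rw [e] at h2
  have a1 := Real.sq_sqrt (hc.le.trans hp.1)
  have a2 := Real.sq_sqrt (hc.le.trans hq.1)
  have a3 := Real.sq_sqrt (show 0 ≤ 1 - p by linarith [hp.2])
  have a4 := Real.sq_sqrt (show 0 ≤ 1 - q by linarith [hq.2])
  simp only [bernoulliMass, Fintype.univ_bool, Finset.mem_singleton, Bool.true_eq_false,
    not_false_eq_true, Finset.sum_insert, Finset.sum_singleton, if_true, Bool.false_eq_true,
    if_false]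
  nlinarith

theorem one_sub_sum_le_prod_of_one_sub_le {ι : Type*} (s : Finset ι) {x ρ : ι → ℝ}
    (hρ0 : ∀ i ∈ s, 0 ≤ ρ i) (hρ1 : ∀ i ∈ s, ρ i ≤ 1) (h : ∀ i ∈ s, 1 - x i ≤ ρ i) :
    1 - ∑ i ∈ s, x i ≤ ∏ i ∈ s, ρ i := by
  classical
  induction s using Finset.induction_on with
  | empty => simp
  | insert a s ha ih =>
    rw [Finset.sum_insert ha, Finset.prod_insert ha]
    simp only [Finset.mem_insert, forall_eq_or_imp] at hρ0 hρ1 h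
    have h1 := ih hρ0.2 hρ1.2 h.2
    have h2 : ∏ i ∈ s, ρ i ≤ 1 := Finset.prod_le_one hρ0.2 hρ1.2
    have h3 := Finset.prod_nonneg hρ0.2
    nlinarith [h.1, hρ0.1, hρ1.1, mul_nonneg (sub_nonneg.2 h2) (sub_nonneg.2 hρ1.1)]

theorem affinity_le_one {p q : ℝ} (hp : p ∈ Set.Icc (0 : ℝ) 1) (hq : q ∈ Set.Icc (0 : ℝ) 1) :
    ∑ b, √(bernoulliMass p b) * √(bernoulliMass q b) ≤ 1 := by
  have a1 := Real.sq_sqrt hp.1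
  have a2 := Real.sq_sqrt hq.1
  have a3 := Real.sq_sqrt (show 0 ≤ 1 - p by linarith [hp.2])
  have a4 := Real.sq_sqrt (show 0 ≤ 1 - q by linarith [hq.2])
  simp only [bernoulliMass, Fintype.univ_bool, Finset.mem_singleton, Bool.true_eq_false,
    not_false_eq_true, Finset.sum_insert, Finset.sum_singleton, if_true, Bool.false_eq_true,
    if_false]
  nlinarith [sq_nonneg (√p - √q), sq_nonneg (√(1 - p) - √(1 - q))]

/-- Affinity is multiplicative over independent coordinates, and `1 - ∏ ρ ≤ ∑ (1 - ρ)` for factors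
in `[0, 1]`. -/
theorem one_sub_le_affinity_bernoulliProd {ι : Type*} [Fintype ι] [DecidableEq ι] {c : ℝ}
    (hc : 0 < c) {p q : ι → ℝ} (hp : ∀ i, p i ∈ Set.Icc c (1 - c))
    (hq : ∀ i, q i ∈ Set.Icc c (1 - c)) :
    1 - (∑ i, (p i - q i) ^ 2) / (4 * c)
      ≤ ∑ Z : ι → Bool, √(bernoulliProd p Z) * √(bernoulliProd q Z) := by
  have hp' : ∀ i, p i ∈ Set.Icc (0 : ℝ) 1 := fun i =>
    ⟨hc.le.trans (hp i).1, by linarith [(hp i).2]⟩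
  have hq' : ∀ i, q i ∈ Set.Icc (0 : ℝ) 1 := fun i =>
    ⟨hc.le.trans (hq i).1, by linarith [(hq i).2]⟩
  have e : ∑ Z : ι → Bool, √(bernoulliProd p Z) * √(bernoulliProd q Z)
      = ∏ i, ∑ b, √(bernoulliMass (p i) b) * √(bernoulliMass (q i) b) := by
    rw [Fintype.prod_sum]
    refine Finset.sum_congr rfl fun Z _ => ?_
    rw [bernoulliProd, bernoulliProd,
      Real.sqrt_prod _ fun i _ => bernoulliMass_nonneg (hp' i) _,
      Real.sqrt_prod _ fun i _ => bernoulliMass_nonneg (hq' i) _, Finset.prod_mul_distrib]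
  rw [e, Finset.sum_div]
  exact one_sub_sum_le_prod_of_one_sub_le _ (fun i _ => Finset.sum_nonneg fun b _ => by positivity)
    (fun i _ => affinity_le_one (hp' i) (hq' i)) fun i _ => one_sub_affinity_le hc (hp i) (hq i)

/-- The Le Cam bound: the overlap of two mass functions is at least half their squared affinity. -/
theorem sq_affinity_le_two_mul_sum_min {α : Type*} [Fintype α] {P Q : α → ℝ}
    (hP : ∀ a, 0 ≤ P a) (hQ : ∀ a, 0 ≤ Q a) (hP1 : ∑ a, P a = 1) (hQ1 : ∑ a, Q a = 1) :
    (∑ a, √(P a) * √(Q a)) ^ 2 ≤ 2 * ∑ a, min (P a) (Q a) := by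
  have hmin : ∀ a, 0 ≤ min (P a) (Q a) := fun a => le_min (hP a) (hQ a)
  have hmax : ∀ a, 0 ≤ max (P a) (Q a) := fun a => (hP a).trans (le_max_left _ _)
  -- Cauchy–Schwarz applied to `P Q = min P Q * max P Q`.
  have h1 := Finset.sum_sq_le_sum_mul_sum_of_sq_le_mul Finset.univ
    (r := fun a => √(P a) * √(Q a)) (f := fun a => min (P a) (Q a)) (g := fun a => max (P a) (Q a))
    (fun a _ => hmin a) (fun a _ => hmax a) fun a _ => by
      rw [mul_pow, Real.sq_sqrt (hP a), Real.sq_sqrt (hQ a), min_mul_max]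
  have h2 : ∑ a, max (P a) (Q a) ≤ 2 := by
    calc ∑ a, max (P a) (Q a) ≤ ∑ a, (P a + Q a) :=
          Finset.sum_le_sum fun a _ => max_le (by linarith [hQ a]) (by linarith [hP a])
      _ = 2 := by rw [Finset.sum_add_distrib, hP1, hQ1]; norm_num
  have h3 : 0 ≤ ∑ a, min (P a) (Q a) := Finset.sum_nonneg fun a _ => hmin a
  nlinarith

/-! ### The risk as a finite sum -/

/-- The pairs `i ≤ j` whose comparisons are drawn independently. -/
abbrev UpperPair (n : ℕ) : Type := {p : Fin n × Fin n // p.1 ≤ p.2}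

/-- The comparison probabilities of the weights `w` along the independent pairs. -/
def pairProb (F : ℝ → ℝ) {n : ℕ} (w : Fin n → ℝ) (p : UpperPair n) : ℝ :=
  F (w p.1.1 - w p.1.2)

theorem risk_inducedMatrix {F : ℝ → ℝ} (hF : IsValidLink F) {n : ℕ}
    (Mhat : Observation n → Matrix (Fin n) (Fin n) ℝ) (w : Fin n → ℝ) :
    risk Mhat (inducedMatrix F w) = ENNReal.ofReal (∑ Z : UpperPair n → Bool,
      bernoulliProd (pairProb F w) Z * (1 / (n : ℝ) ^ 2 *
        frobeniusSq (Mhat (completeObservation Z) - inducedMatrix F w))) := by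
  have hq : ∀ p, pairProb F w p ∈ Set.Icc (0 : ℝ) 1 := fun p => hF.mem_Icc _
  have hfrob : ∀ A : Matrix (Fin n) (Fin n) ℝ, 0 ≤ 1 / (n : ℝ) ^ 2 * frobeniusSq A := fun A => by
    unfold frobeniusSq; positivity
  unfold risk observationLaw
  rw [lintegral_map (measurable_of_finite _) (measurable_of_finite _), lintegral_fintype,
    ENNReal.ofReal_sum_of_nonneg fun Z _ => mul_nonneg (bernoulliProd_nonneg hq Z) (hfrob _)]
  refine Finset.sum_congr rfl fun Z _ => ?_
  rw [Measure.pi_singleton, mul_comm, ENNReal.ofReal_mul (bernoulliProd_nonneg hq Z),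
    bernoulliProd, ENNReal.ofReal_prod_of_nonneg fun i _ => bernoulliMass_nonneg (hq i) _]
  congr 1
  exact Finset.prod_congr rfl fun p _ => bernoulliLaw_singleton _ _

/-! ### Sums over pairs -/

theorem sum_sum_sub_sq {n : ℕ} {δ : Fin n → ℝ} (h : ∑ i, δ i = 0) :
    ∑ i, ∑ j, (δ i - δ j) ^ 2 = 2 * (n * ∑ i, δ i ^ 2) := by
  have e : ∀ i j, (δ i - δ j) ^ 2 = δ i ^ 2 - 2 * (δ i * δ j) + δ j ^ 2 := fun i j => by ring
  simp only [e, Finset.sum_add_distrib, Finset.sum_sub_distrib, ← Finset.mul_sum, h,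
    Finset.sum_const, Finset.card_univ, Fintype.card_fin, nsmul_eq_mul, mul_zero]
  ring

/-- The likelihood runs over `i < j` and the data over `i ≤ j`; terms vanishing on the diagonal make
the two interchangeable. -/
theorem sum_Ioi_eq_sum_upperPair {n : ℕ} {f : Fin n → Fin n → ℝ} (h : ∀ i, f i i = 0) :
    ∑ i, ∑ j ∈ Finset.Ioi i, f i j = ∑ p : UpperPair n, f p.1.1 p.1.2 := by
  have e1 : ∑ p : UpperPair n, f p.1.1 p.1.2
      = ∑ p : Fin n × Fin n with p.1 ≤ p.2, f p.1 p.2 :=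
    (Finset.sum_subtype (p := fun p : Fin n × Fin n => p.1 ≤ p.2) _ (by simp)
      fun p => f p.1 p.2).symm
  rw [e1, Finset.sum_filter, Fintype.sum_prod_type]
  refine Finset.sum_congr rfl fun i _ => ?_
  rw [← Finset.sum_filter]
  refine Finset.sum_subset (fun j hj => ?_) fun j hj hj' => ?_
  · simpa using (Finset.mem_Ioi.1 hj).le
  · have h1 : i ≤ j := by simpa using hj
    have h2 : j ≤ i := by simpa using hj'
    rw [le_antisymm h1 h2, h]

theorem sum_upperPair_sub_sq {n : ℕ} {δ : Fin n → ℝ} (h : ∑ i, δ i = 0) :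
    ∑ p : UpperPair n, (δ p.1.1 - δ p.1.2) ^ 2 = n * ∑ i, δ i ^ 2 := by
  have h1 := sum_sum_sub_sq h
  rw [← sum_Ioi_eq_sum_upperPair (f := fun i j => (δ i - δ j) ^ 2) (by simp)]
  have h2 : ∑ i, ∑ j, (δ i - δ j) ^ 2
      = ∑ i, ∑ j ∈ Finset.Ioi i, (δ i - δ j) ^ 2 + ∑ i, ∑ j ∈ Finset.Ioi i, (δ j - δ i) ^ 2 := by
    have h3 : ∑ i, ∑ j ∈ Finset.Ioi i, (δ j - δ i) ^ 2
        = ∑ i, ∑ j ∈ Finset.Iio i, (δ i - δ j) ^ 2 :=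
      Finset.sum_comm' fun i j => by simp
    rw [h3, ← Finset.sum_add_distrib]
    refine Finset.sum_congr rfl fun i _ => ?_
    rw [← Finset.sum_filter_add_sum_filter_not Finset.univ (fun j => i < j)]
    congr 1
    · exact Finset.sum_congr (by ext; simp) fun _ _ => rfl
    · symm
      refine Finset.sum_subset (fun j hj => by simpa using (Finset.mem_Iio.1 hj).le)
        fun j hj hj' => ?_
      have e : i = j := le_antisymm (by simpa using hj') (by simpa using hj)
      simp [e]
  have h4 : ∀ i j, (δ j - δ i) ^ 2 = (δ i - δ j) ^ 2 := fun i j => by ring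
  simp only [h4] at h2
  linarith

/-! ### The maximum likelihood estimate -/

/-- The probability of the outcome `b` of a comparison with weight difference `t`. -/
def outcomeProb (F : ℝ → ℝ) (t : ℝ) (b : Bool) : ℝ := if b then F t else 1 - F t

/-- The derivative in `t` of the logarithm of `outcomeProb F t b`. -/
noncomputable def outcomeScore (F : ℝ → ℝ) (t : ℝ) (b : Bool) : ℝ :=
  if b then linkScore F t else -linkScore F (-t)

theorem IsValidLink.outcomeProb_pos {F : ℝ → ℝ} (hF : IsValidLink F) (hmono : StrictMono F)
    (t : ℝ) (b : Bool) : 0 < outcomeProb F t b := by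
  cases b
  · simpa [outcomeProb, hF.neg_eq] using hF.pos hmono (-t)
  · simpa [outcomeProb] using hF.pos hmono t

/-- By symmetry a loss has probability `F (-t)`, so both outcomes reduce to concavity of `log F`, at
reflected points for `false`. -/
theorem log_outcomeProb_le {F : ℝ → ℝ} (hF : IsValidLink F) (hmono : StrictMono F)
    (hd : Differentiable ℝ F) {γ : ℝ}
    (hc : StrongConcaveOn (Set.Icc (-2 : ℝ) 2) γ fun t => Real.log (F t)) {x y : ℝ}
    (hx : x ∈ Set.Icc (-2 : ℝ) 2) (hy : y ∈ Set.Icc (-2 : ℝ) 2) (b : Bool) :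
    Real.log (outcomeProb F y b) ≤ Real.log (outcomeProb F x b) + outcomeScore F x b * (y - x)
      - γ / 2 * (y - x) ^ 2 := by
  cases b
  · have := hc.le_tangent (x := -x) (y := -y) ⟨by linarith [hx.2], by linarith [hx.1]⟩
      ⟨by linarith [hy.2], by linarith [hy.1]⟩ (hasDerivAt_log_link hF hmono hd (-x))
    rw [hF.neg_eq, hF.neg_eq] at this
    simp only [outcomeProb, outcomeScore, Bool.false_eq_true, if_false]
    nlinarith
  · simpa [outcomeProb, outcomeScore] using
      hc.le_tangent hx hy (hasDerivAt_log_link hF hmono hd x)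

theorem sub_mem_Icc_of_mem_weightSet {n : ℕ} {w : Fin n → ℝ} (hw : w ∈ weightSet n)
    (i j : Fin n) : w i - w j ∈ Set.Icc (-2 : ℝ) 2 := by
  have h1 := abs_le.1 (hw.2 i)
  have h2 := abs_le.1 (hw.2 j)
  exact ⟨by linarith, by linarith⟩

theorem likelihood_pos {F : ℝ → ℝ} (hF : IsValidLink F) (hmono : StrictMono F) {n : ℕ}
    (Y : Observation n) (w : Fin n → ℝ) : 0 < likelihood F Y w :=
  Finset.prod_pos fun i _ => Finset.prod_pos fun j _ =>
    hF.outcomeProb_pos hmono (w i - w j) (Y i j)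

theorem log_likelihood {F : ℝ → ℝ} (hF : IsValidLink F) (hmono : StrictMono F) {n : ℕ}
    (Y : Observation n) (w : Fin n → ℝ) :
    Real.log (likelihood F Y w)
      = ∑ i, ∑ j ∈ Finset.Ioi i, Real.log (outcomeProb F (w i - w j) (Y i j)) := by
  have hpos := fun i j => (hF.outcomeProb_pos hmono (w i - w j) (Y i j))
  change Real.log (∏ i, ∏ j ∈ Finset.Ioi i, outcomeProb F (w i - w j) (Y i j)) = _
  rw [Real.log_prod fun i _ => (Finset.prod_pos fun j _ => hpos i j).ne']
  exact Finset.sum_congr rfl fun i _ => Real.log_prod fun j _ => (hpos i j).ne'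

/-- The log-likelihood lies below a paraboloid touching it at `w`. -/
theorem log_likelihood_le {F : ℝ → ℝ} (hF : IsValidLink F) (hmono : StrictMono F)
    (hd : Differentiable ℝ F) {γ : ℝ}
    (hc : StrongConcaveOn (Set.Icc (-2 : ℝ) 2) γ fun t => Real.log (F t)) {n : ℕ}
    (Y : Observation n) {w v : Fin n → ℝ} (hw : w ∈ weightSet n) (hv : v ∈ weightSet n) :
    Real.log (likelihood F Y v) ≤ Real.log (likelihood F Y w)
      + ∑ p : UpperPair n, outcomeScore F (w p.1.1 - w p.1.2) (Y p.1.1 p.1.2)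
          * ((v p.1.1 - w p.1.1) - (v p.1.2 - w p.1.2))
      - γ / 2 * (n * ∑ i, (v i - w i) ^ 2) := by
  have hδ : ∑ i, (v i - w i) = 0 := by rw [Finset.sum_sub_distrib, hv.1, hw.1, sub_zero]
  rw [log_likelihood hF hmono, log_likelihood hF hmono, ← sum_upperPair_sub_sq hδ,
    ← sum_Ioi_eq_sum_upperPair (f := fun i j => ((v i - w i) - (v j - w j)) ^ 2) (by simp),
    ← sum_Ioi_eq_sum_upperPair (f := fun i j => outcomeScore F (w i - w j) (Y i j)
          * ((v i - w i) - (v j - w j))) (by simp)]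
  simp only [Finset.mul_sum, ← Finset.sum_add_distrib, ← Finset.sum_sub_distrib]
  refine Finset.sum_le_sum fun i _ => Finset.sum_le_sum fun j _ => ?_
  have := log_outcomeProb_le hF hmono hd hc (sub_mem_Icc_of_mem_weightSet hw i j)
    (sub_mem_Icc_of_mem_weightSet hv i j) (Y i j)
  have e : v i - v j - (w i - w j) = v i - w i - (v j - w j) := by ring
  rwa [e] at this

theorem isCompact_weightSet (n : ℕ) : IsCompact (weightSet n) := by
  have h : IsCompact (Set.univ.pi fun _ : Fin n => Set.Icc (-1 : ℝ) 1) :=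
    isCompact_univ_pi fun _ => isCompact_Icc
  have e : weightSet n = {w | ∑ i, w i = 0} ∩ Set.univ.pi fun _ : Fin n => Set.Icc (-1 : ℝ) 1 := by
    ext w
    simp only [weightSet, abs_le, Set.mem_ofPred_eq, Set.mem_inter_iff, Set.mem_pi, Set.mem_univ,
      true_imp_iff, Set.mem_Icc]
  rw [e]
  exact h.inter_left (isClosed_eq (by fun_prop) continuous_const)

theorem exists_isMLE {F : ℝ → ℝ} (hd : Differentiable ℝ F) {n : ℕ} (Y : Observation n) :
    ∃ w, IsMLE F Y w := by
  have hcont : Continuous (likelihood F Y) := by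
    have := hd.continuous
    unfold likelihood
    refine continuous_finsetProd _ fun i _ => continuous_finsetProd _ fun j _ => ?_
    split_ifs <;> fun_prop
  obtain ⟨w, hw, hmax⟩ := (isCompact_weightSet n).exists_isMaxOn
    ⟨0, by simp [weightSet]⟩ hcont.continuousOn
  exact ⟨w, hw, hmax⟩

theorem IsMLE.log_likelihood_le {F : ℝ → ℝ} (hF : IsValidLink F) (hmono : StrictMono F) {n : ℕ}
    {Y : Observation n} {w v : Fin n → ℝ} (hw : IsMLE F Y w) (hv : v ∈ weightSet n) :
    Real.log (likelihood F Y v) ≤ Real.log (likelihood F Y w) :=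
  Real.log_le_log (likelihood_pos hF hmono Y v) (hw.2 hv)

/-- Expanding at the midpoint `w` of two maximizers, the linear terms cancel because `u - w = -(v -
w)`, and what remains would put both strictly below `w` on average. -/
theorem IsMLE.unique {F : ℝ → ℝ} (hF : IsValidLink F) (hmono : StrictMono F)
    (hconc : IsStronglyLogConcave F) (hd : Differentiable ℝ F) {n : ℕ} {Y : Observation n}
    {u v : Fin n → ℝ} (hu : IsMLE F Y u) (hv : IsMLE F Y v) : u = v := by
  obtain ⟨γ, hγ, hc⟩ := hconc
  set w : Fin n → ℝ := fun i => (u i + v i) / 2 with hwdef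
  have hw : w ∈ weightSet n := by
    refine ⟨?_, fun i => ?_⟩
    · simp only [hwdef]
      rw [← Finset.sum_div, Finset.sum_add_distrib, hu.1.1, hv.1.1]
      simp
    · have h1 := abs_le.1 (hu.1.2 i)
      have h2 := abs_le.1 (hv.1.2 i)
      exact abs_le.2 ⟨by simp only [hwdef]; linarith, by simp only [hwdef]; linarith⟩
  have h1 := _root_.log_likelihood_le hF hmono hd hc Y hw hu.1
  have h2 := _root_.log_likelihood_le hF hmono hd hc Y hw hv.1
  have h3 := hu.log_likelihood_le hF hmono hw
  have h4 := hv.log_likelihood_le hF hmono hw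
  have h5 : ∑ p : UpperPair n, outcomeScore F (w p.1.1 - w p.1.2) (Y p.1.1 p.1.2)
          * ((u p.1.1 - w p.1.1) - (u p.1.2 - w p.1.2))
      + ∑ p : UpperPair n, outcomeScore F (w p.1.1 - w p.1.2) (Y p.1.1 p.1.2)
          * ((v p.1.1 - w p.1.1) - (v p.1.2 - w p.1.2)) = 0 := by
    rw [← Finset.sum_add_distrib]
    exact Finset.sum_eq_zero fun p _ => by simp only [hwdef]; ring
  have h6 : 0 ≤ ∑ i, (v i - w i) ^ 2 := by positivity
  have h7 : n * ∑ i, (u i - w i) ^ 2 ≤ 0 := by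
    by_contra! h
    have h8 : 0 ≤ γ / 2 * (n * ∑ i, (v i - w i) ^ 2) := by positivity
    have h9 : 0 < γ / 2 * (n * ∑ i, (u i - w i) ^ 2) := by positivity
    linarith
  funext i
  have hn : (0 : ℝ) < n := by exact_mod_cast i.pos
  have h8 : ∑ i, (u i - w i) ^ 2 ≤ 0 := nonpos_of_mul_nonpos_right h7 hn
  have h9 : (u i - w i) ^ 2 ≤ 0 :=
    (Finset.single_le_sum (f := fun i => (u i - w i) ^ 2) (fun j _ => sq_nonneg _)
      (Finset.mem_univ i)).trans h8
  have h10 : u i - w i = 0 := by nlinarith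
  simp only [hwdef] at h10
  linarith

/-! ### Upper bound on the risk of the maximum likelihood estimate -/

/-- The `k`-th coordinate of the gradient of the log-likelihood at `w`. -/
noncomputable def likelihoodScore (F : ℝ → ℝ) {n : ℕ} (w : Fin n → ℝ) (Z : UpperPair n → Bool)
    (k : Fin n) : ℝ :=
  ∑ p : UpperPair n, ((if p.1.1 = k then 1 else 0) - (if p.1.2 = k then 1 else 0))
    * outcomeScore F (w p.1.1 - w p.1.2) (Z p)

theorem sum_outcomeScore_mul_sub {F : ℝ → ℝ} {n : ℕ} (w δ : Fin n → ℝ)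
    (Z : UpperPair n → Bool) :
    ∑ p : UpperPair n, outcomeScore F (w p.1.1 - w p.1.2) (Z p) * (δ p.1.1 - δ p.1.2)
      = ∑ k, δ k * likelihoodScore F w Z k := by
  simp only [likelihoodScore, Finset.mul_sum]
  rw [Finset.sum_comm]
  refine Finset.sum_congr rfl fun p _ => ?_
  simp [mul_sub, Finset.sum_sub_distrib, mul_comm]

/-- The mean is `F'(t) - F'(-t)`, and `F'` is even. -/
theorem sum_bernoulliMass_mul_outcomeScore {F : ℝ → ℝ} (hF : IsValidLink F)
    (hmono : StrictMono F) (hd : Differentiable ℝ F) (t : ℝ) :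
    ∑ b, bernoulliMass (F t) b * outcomeScore F t b = 0 := by
  have h1 := deriv_eq_link_mul_linkScore hF hmono t
  have h2 := deriv_eq_link_mul_linkScore hF hmono (-t)
  rw [hF.deriv_neg hd, hF.neg_eq] at h2
  simp only [bernoulliMass, outcomeScore, Fintype.univ_bool, Finset.mem_singleton,
    Bool.true_eq_false, not_false_eq_true, Finset.sum_insert, Finset.sum_singleton, if_true,
    Bool.false_eq_true, if_false]
  linarith

theorem abs_outcomeScore_le {F : ℝ → ℝ} {B : ℝ}
    (hB : ∀ t ∈ Set.Icc (-2 : ℝ) 2, |linkScore F t| ≤ B) {t : ℝ} (ht : t ∈ Set.Icc (-2 : ℝ) 2)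
    (b : Bool) : |outcomeScore F t b| ≤ B := by
  cases b
  · simpa [outcomeScore] using hB (-t) ⟨by linarith [ht.2], by linarith [ht.1]⟩
  · simpa [outcomeScore] using hB t ht

/-- Each coordinate is a combination of independent centred scores. Summed over `k`, the squared
coefficients of one pair total at most 2, and there are at most `n²` pairs. -/
theorem sum_bernoulliProd_mul_likelihoodScore_sq_le {F : ℝ → ℝ} (hF : IsValidLink F)
    (hmono : StrictMono F) (hd : Differentiable ℝ F) {B : ℝ}
    (hB : ∀ t ∈ Set.Icc (-2 : ℝ) 2, |linkScore F t| ≤ B) {n : ℕ} {w : Fin n → ℝ}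
    (hw : w ∈ weightSet n) :
    ∑ Z : UpperPair n → Bool, bernoulliProd (pairProb F w) Z * ∑ k, likelihoodScore F w Z k ^ 2
      ≤ 2 * B ^ 2 * (n : ℝ) ^ 2 := by
  simp only [Finset.mul_sum]
  rw [Finset.sum_comm]
  have h1 : ∀ k, ∑ Z : UpperPair n → Bool,
      bernoulliProd (pairProb F w) Z * likelihoodScore F w Z k ^ 2
      ≤ B ^ 2 * ∑ p : UpperPair n,
        (((if p.1.1 = k then 1 else 0) - (if p.1.2 = k then 1 else 0) : ℝ)) ^ 2 := by
    intro k
    exact sum_bernoulliProd_mul_sq_le (q := pairProb F w) (fun p => hF.mem_Icc _)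
      (fun p b => outcomeScore F (w p.1.1 - w p.1.2) b)
      (fun p => sum_bernoulliMass_mul_outcomeScore hF hmono hd _)
      (fun p b => abs_outcomeScore_le hB (sub_mem_Icc_of_mem_weightSet hw _ _) b)
      (fun p => (if p.1.1 = k then 1 else 0) - (if p.1.2 = k then 1 else 0))
  refine (Finset.sum_le_sum fun k _ => h1 k).trans ?_
  rw [← Finset.mul_sum, Finset.sum_comm]
  have h2 : ∀ p : UpperPair n, ∑ k,
      (((if p.1.1 = k then 1 else 0) - (if p.1.2 = k then 1 else 0) : ℝ)) ^ 2 ≤ 2 := by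
    intro p
    calc ∑ k, (((if p.1.1 = k then 1 else 0) - (if p.1.2 = k then 1 else 0) : ℝ)) ^ 2
        ≤ ∑ k, ((if p.1.1 = k then 1 else 0) + (if p.1.2 = k then 1 else 0) : ℝ) :=
          Finset.sum_le_sum fun k _ => by split_ifs <;> norm_num
      _ = 2 := by rw [Finset.sum_add_distrib]; simp; norm_num
  have h3 : (Fintype.card (UpperPair n) : ℝ) ≤ (n : ℝ) ^ 2 := by
    have := Fintype.card_subtype_le fun p : Fin n × Fin n => p.1 ≤ p.2
    rw [Fintype.card_prod, Fintype.card_fin, ← sq] at this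
    exact_mod_cast this
  have h4 := Finset.sum_le_card_nsmul Finset.univ _ _ fun p (_ : p ∈ Finset.univ) => h2 p
  rw [Finset.card_univ, nsmul_eq_mul] at h4
  nlinarith [sq_nonneg B]

theorem completeObservation_upperPair {n : ℕ} (Z : UpperPair n → Bool) (p : UpperPair n) :
    completeObservation Z p.1.1 p.1.2 = Z p := by
  simp [completeObservation, p.2]

theorem IsMLE.sum_sub_sq_le {F : ℝ → ℝ} (hF : IsValidLink F) (hmono : StrictMono F)
    (hd : Differentiable ℝ F) {γ : ℝ} (hγ : 0 < γ)
    (hc : StrongConcaveOn (Set.Icc (-2 : ℝ) 2) γ fun t => Real.log (F t)) {n : ℕ} (hn : 0 < n)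
    {Z : UpperPair n → Bool} {w v : Fin n → ℝ} (hw : w ∈ weightSet n)
    (hv : IsMLE F (completeObservation Z) v) :
    ∑ i, (v i - w i) ^ 2 ≤ 4 / (γ ^ 2 * (n : ℝ) ^ 2) * ∑ k, likelihoodScore F w Z k ^ 2 := by
  have h1 := _root_.log_likelihood_le hF hmono hd hc (completeObservation Z) hw hv.1
  have h2 := hv.log_likelihood_le hF hmono hw
  simp only [completeObservation_upperPair] at h1
  rw [sum_outcomeScore_mul_sub w (fun i => v i - w i) Z] at h1
  have hn' : (0 : ℝ) < n := by exact_mod_cast hn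
  have h3 := Finset.sum_mul_sq_le_sq_mul_sq Finset.univ (fun k => v k - w k)
    (likelihoodScore F w Z)
  set D := ∑ i, (v i - w i) ^ 2
  set S := ∑ k, likelihoodScore F w Z k ^ 2
  set I := ∑ k, (v k - w k) * likelihoodScore F w Z k
  have hD : 0 ≤ D := by positivity
  have hS : 0 ≤ S := by positivity
  have h4 : γ / 2 * (n * D) ≤ I := by linarith
  have h5 : (γ / 2 * (n * D)) ^ 2 ≤ D * S := (pow_le_pow_left₀ (by positivity) h4 2).trans h3
  -- A factor `D` is about to be cancelled, so `D = 0` is treated apart.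
  rcases hD.eq_or_lt with h | h
  · rw [← h]; positivity
  · have h6 : γ ^ 2 * (n : ℝ) ^ 2 * D ≤ 4 * S := by
      have : D * (γ ^ 2 * (n : ℝ) ^ 2 * D) ≤ D * (4 * S) := by nlinarith
      exact le_of_mul_le_mul_left this h
    rw [div_mul_eq_mul_div, le_div_iff₀ (by positivity)]
    linarith

theorem frobeniusSq_inducedMatrix_sub_le {F : ℝ → ℝ} (hF : IsValidLink F) (hmono : StrictMono F)
    (hd : Differentiable ℝ F) {B : ℝ} (hB : ∀ t ∈ Set.Icc (-2 : ℝ) 2, |linkScore F t| ≤ B)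
    {n : ℕ} {v w : Fin n → ℝ} (hv : v ∈ weightSet n) (hw : w ∈ weightSet n) :
    frobeniusSq (inducedMatrix F v - inducedMatrix F w)
      ≤ B ^ 2 * (2 * (n * ∑ i, (v i - w i) ^ 2)) := by
  have hδ : ∑ i, (v i - w i) = 0 := by rw [Finset.sum_sub_distrib, hv.1, hw.1, sub_zero]
  rw [← sum_sum_sub_sq hδ]
  simp only [frobeniusSq, Finset.mul_sum]
  refine Finset.sum_le_sum fun i _ => Finset.sum_le_sum fun j _ => ?_
  have := abs_link_sub_le hF hmono hd hB (sub_mem_Icc_of_mem_weightSet hv i j)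
    (sub_mem_Icc_of_mem_weightSet hw i j)
  have h2 := pow_le_pow_left₀ (abs_nonneg _) this 2
  rw [mul_pow, sq_abs, sq_abs] at h2
  have e : v i - w i - (v j - w j) = v i - v j - (w i - w j) := by ring
  rw [e]
  simpa [inducedMatrix] using h2

/-- The constant multiplies the loss factor `2B²n / n²`, the factor `4 / (γ²n²)` from the score
bound, and the score moment `2B²n²`. -/
theorem risk_mle_le {F : ℝ → ℝ} (hF : IsValidLink F) (hmono : StrictMono F)
    (hd : Differentiable ℝ F) {γ : ℝ} (hγ : 0 < γ)
    (hc : StrongConcaveOn (Set.Icc (-2 : ℝ) 2) γ fun t => Real.log (F t)) {B : ℝ}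
    (hB : ∀ t ∈ Set.Icc (-2 : ℝ) 2, |linkScore F t| ≤ B) {n : ℕ} (hn : 0 < n)
    {what : Observation n → Fin n → ℝ} (hwhat : ∀ Y, IsMLE F Y (what Y)) {w : Fin n → ℝ}
    (hw : w ∈ weightSet n) :
    risk (fun Y => inducedMatrix F (what Y)) (inducedMatrix F w)
      ≤ ENNReal.ofReal (16 * B ^ 4 / γ ^ 2 / n) := by
  have hn' : (0 : ℝ) < n := by exact_mod_cast hn
  rw [risk_inducedMatrix hF]
  refine ENNReal.ofReal_le_ofReal ?_
  have h1 : ∀ Z : UpperPair n → Bool, 1 / (n : ℝ) ^ 2 *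
      frobeniusSq (inducedMatrix F (what (completeObservation Z)) - inducedMatrix F w)
      ≤ 8 * B ^ 2 / (γ ^ 2 * (n : ℝ) ^ 3) * ∑ k, likelihoodScore F w Z k ^ 2 := by
    intro Z
    have hv := hwhat (completeObservation Z)
    calc _ ≤ 1 / (n : ℝ) ^ 2 * (B ^ 2 * (2 * (n * (4 / (γ ^ 2 * (n : ℝ) ^ 2)
            * ∑ k, likelihoodScore F w Z k ^ 2)))) := by
          have := frobeniusSq_inducedMatrix_sub_le hF hmono hd hB hv.1 hw
          have h2 := hv.sum_sub_sq_le hF hmono hd hγ hc hn hw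
          refine mul_le_mul_of_nonneg_left (this.trans ?_) (by positivity)
          gcongr
      _ = _ := by field_simp; ring
  calc _ ≤ ∑ Z : UpperPair n → Bool, bernoulliProd (pairProb F w) Z *
        (8 * B ^ 2 / (γ ^ 2 * (n : ℝ) ^ 3) * ∑ k, likelihoodScore F w Z k ^ 2) :=
        Finset.sum_le_sum fun Z _ => mul_le_mul_of_nonneg_left (h1 Z)
          (bernoulliProd_nonneg (fun p => hF.mem_Icc _) Z)
    _ = 8 * B ^ 2 / (γ ^ 2 * (n : ℝ) ^ 3) * ∑ Z : UpperPair n → Bool,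
        bernoulliProd (pairProb F w) Z * ∑ k, likelihoodScore F w Z k ^ 2 := by
        rw [Finset.mul_sum]
        exact Finset.sum_congr rfl fun Z _ => by ring
    _ ≤ 8 * B ^ 2 / (γ ^ 2 * (n : ℝ) ^ 3) * (2 * B ^ 2 * (n : ℝ) ^ 2) :=
        mul_le_mul_of_nonneg_left (sum_bernoulliProd_mul_likelihoodScore_sq_le hF hmono hd hB hw)
          (by positivity)
    _ = _ := by field_simp; ring
/-! ### Lower bound on the minimax risk -/

/-- Two-point testing: if no observation lets both losses be small, the two risks add up to at least
the separation times the overlap of the laws. -/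
theorem mul_sum_min_le {α : Type*} [Fintype α] {P Q u v : α → ℝ} {Δ : ℝ} (hP : ∀ a, 0 ≤ P a)
    (hQ : ∀ a, 0 ≤ Q a) (hu : ∀ a, 0 ≤ u a) (hv : ∀ a, 0 ≤ v a) (h : ∀ a, Δ ≤ u a + v a) :
    Δ * ∑ a, min (P a) (Q a) ≤ ∑ a, P a * u a + ∑ a, Q a * v a := by
  rw [Finset.mul_sum, ← Finset.sum_add_distrib]
  refine Finset.sum_le_sum fun a _ => ?_
  have h0 : 0 ≤ min (P a) (Q a) := le_min (hP a) (hQ a)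
  calc Δ * min (P a) (Q a) ≤ (u a + v a) * min (P a) (Q a) := mul_le_mul_of_nonneg_right (h a) h0
    _ = min (P a) (Q a) * u a + min (P a) (Q a) * v a := by ring
    _ ≤ P a * u a + Q a * v a :=
      add_le_add (mul_le_mul_of_nonneg_right (min_le_left _ _) (hu a))
        (mul_le_mul_of_nonneg_right (min_le_right _ _) (hv a))

/-- The vertex of the hypercube obtained from `σ` by flipping the coordinate `k`. -/
def flipAt {κ : Type*} [DecidableEq κ] (k : κ) (σ : κ → Bool) : κ → Bool :=
  Function.update σ k (!σ k)

theorem flipAt_involutive {κ : Type*} [DecidableEq κ] (k : κ) :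
    Function.Involutive (flipAt (κ := κ) k) := by
  intro σ
  simp [flipAt]

/-- The Assouad lemma in averaged form. -/
theorem exists_card_mul_le_sum_of_flipAt {κ : Type*} [Fintype κ] [DecidableEq κ]
    {G : κ → (κ → Bool) → ℝ} {L : ℝ} (h : ∀ k σ, L ≤ G k σ + G k (flipAt k σ)) :
    ∃ σ, Fintype.card κ * (L / 2) ≤ ∑ k, G k σ := by
  have h1 : ∀ k, ∑ _σ : κ → Bool, L / 2 ≤ ∑ σ, G k σ := by
    intro k
    -- Flipping permutes the cube, so averaging over all vertices halves the pairwise bound for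
    -- every `k` at once.
    have e : ∑ σ, G k (flipAt k σ) = ∑ σ, G k σ :=
      Equiv.sum_comp (flipAt_involutive k).toPerm (G k)
    have h2 : ∑ _σ : κ → Bool, L ≤ ∑ σ, (G k σ + G k (flipAt k σ)) :=
      Finset.sum_le_sum fun σ _ => h k σ
    rw [Finset.sum_add_distrib, e] at h2
    rw [← Finset.sum_div]
    linarith
  have h2 : ∑ _σ : κ → Bool, Fintype.card κ * (L / 2) ≤ ∑ σ, ∑ k, G k σ := by
    rw [Finset.sum_comm (f := fun σ k => G k σ), ← Finset.mul_sum, ← nsmul_eq_mul]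
    exact Finset.card_nsmul_le_sum Finset.univ _ _ fun k _ => h1 k
  obtain ⟨σ, -, hσ⟩ := Finset.exists_le_of_sum_le Finset.univ_nonempty h2
  exact ⟨σ, hσ⟩

/-- The sign attached to a Boolean. -/
def boolSign (b : Bool) : ℝ := if b then 1 else -1

theorem abs_boolSign (b : Bool) : |boolSign b| = 1 := by cases b <;> simp [boolSign]

theorem boolSign_not (b : Bool) : boolSign (!b) = -boolSign b := by cases b <;> simp [boolSign]

section CubeWeight

variable {n : ℕ} {κ : Type*} [Fintype κ] (a b : κ → Fin n) (ε : ℝ)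

/-- The weights in which the items `a k` and `b k` get the opposite weights `± ε`, with signs
prescribed by `σ`. -/
def cubeWeight (σ : κ → Bool) (i : Fin n) : ℝ :=
  ∑ k, ε * boolSign (σ k) * ((if a k = i then 1 else 0) - (if b k = i then 1 else 0))

theorem sum_cubeWeight (σ : κ → Bool) : ∑ i, cubeWeight a b ε σ i = 0 := by
  unfold cubeWeight
  rw [Finset.sum_comm]
  refine Finset.sum_eq_zero fun k _ => ?_
  rw [← Finset.mul_sum, Finset.sum_sub_distrib]
  simp

variable {a b ε}

/-- Each item belongs to at most one pair, in one role, so at most one term is nonzero. -/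
theorem abs_cubeWeight_le (ha : Function.Injective a) (hb : Function.Injective b)
    (hab : ∀ k l, a k ≠ b l) (hε : 0 ≤ ε) (σ : κ → Bool) (i : Fin n) :
    |cubeWeight a b ε σ i| ≤ ε := by
  classical
  have hval : ∀ k, |ε * boolSign (σ k)| = ε := fun k => by
    rw [abs_mul, abs_boolSign, mul_one, abs_of_nonneg hε]
  unfold cubeWeight
  by_cases h1 : ∃ k, a k = i
  · obtain ⟨k, rfl⟩ := h1
    have h2 : ∀ l, b l ≠ a k := fun l => (hab k l).symm
    simp [ha.eq_iff, h2, hval]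
  · push Not at h1
    by_cases h2 : ∃ k, b k = i
    · obtain ⟨k, rfl⟩ := h2
      simp [hb.eq_iff, h1, hval]
    · push Not at h2
      simp [h1, h2, hε]

variable [DecidableEq κ]

theorem cubeWeight_sub_flipAt (σ : κ → Bool) (k : κ) (i : Fin n) :
    cubeWeight a b ε σ i - cubeWeight a b ε (flipAt k σ) i
      = 2 * ε * boolSign (σ k) * ((if a k = i then 1 else 0) - (if b k = i then 1 else 0)) := by
  unfold cubeWeight
  rw [← Finset.sum_sub_distrib, Finset.sum_eq_single k]
  · simp only [flipAt, Function.update_self, boolSign_not]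
    ring
  · intro l _ hl
    simp [flipAt, Function.update_of_ne hl]
  · simp

theorem sum_cubeWeight_sub_flipAt_sq (hab : ∀ k l, a k ≠ b l) (σ : κ → Bool) (k : κ) :
    ∑ i, (cubeWeight a b ε σ i - cubeWeight a b ε (flipAt k σ) i) ^ 2 = 8 * ε ^ 2 := by
  have h1 : boolSign (σ k) ^ 2 = 1 := by rw [← sq_abs, abs_boolSign, one_pow]
  have h2 : ∀ i, ((if a k = i then 1 else 0) - (if b k = i then 1 else 0) : ℝ) ^ 2
      = (if a k = i then 1 else 0) + (if b k = i then 1 else 0) := by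
    intro i
    by_cases h : a k = i
    · have : b k ≠ i := fun h' => hab k k (h.trans h'.symm)
      simp [h, this]
    · simp [h]
  simp only [cubeWeight_sub_flipAt, mul_pow, h1, h2, ← Finset.mul_sum, Finset.sum_add_distrib,
    Finset.sum_ite_eq, Finset.mem_univ, if_true]
  ring

/-- The flip moves `a k` by `2ε`; the only other item it moves is `b k`, in the opposite direction,
so nothing cancels. -/
theorem two_mul_le_abs_cubeWeight_diff (hab : ∀ k l, a k ≠ b l) (hε : 0 ≤ ε) (σ : κ → Bool)
    (k : κ) {j : Fin n} (hj : a k ≠ j) :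
    2 * ε ≤ |(cubeWeight a b ε σ (a k) - cubeWeight a b ε σ j)
      - (cubeWeight a b ε (flipAt k σ) (a k) - cubeWeight a b ε (flipAt k σ) j)| := by
  have e : (cubeWeight a b ε σ (a k) - cubeWeight a b ε σ j)
      - (cubeWeight a b ε (flipAt k σ) (a k) - cubeWeight a b ε (flipAt k σ) j)
      = 2 * ε * (1 + (if b k = j then 1 else 0)) * boolSign (σ k) := by
    have h1 := cubeWeight_sub_flipAt (a := a) (b := b) (ε := ε) σ k (a k)
    have h2 := cubeWeight_sub_flipAt (a := a) (b := b) (ε := ε) σ k j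
    rw [if_pos rfl, if_neg (hab k k).symm] at h1
    rw [if_neg hj] at h2
    linarith
  rw [e, abs_mul, abs_boolSign, mul_one, abs_of_nonneg (by split_ifs <;> linarith)]
  split_ifs <;> linarith

end CubeWeight

/-- The squared error of the estimate `A` in the row `r`, when the weights are `w`. -/
def rowLoss (F : ℝ → ℝ) {n : ℕ} (A : Matrix (Fin n) (Fin n) ℝ) (w : Fin n → ℝ) (r : Fin n) : ℝ :=
  ∑ j, (A r j - F (w r - w j)) ^ 2

theorem rowLoss_nonneg (F : ℝ → ℝ) {n : ℕ} (A : Matrix (Fin n) (Fin n) ℝ) (w : Fin n → ℝ)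
    (r : Fin n) : 0 ≤ rowLoss F A w r := by
  unfold rowLoss; positivity

theorem sum_rowLoss (F : ℝ → ℝ) {n : ℕ} (A : Matrix (Fin n) (Fin n) ℝ) (w : Fin n → ℝ) :
    ∑ r, rowLoss F A w r = frobeniusSq (A - inducedMatrix F w) := by
  simp [rowLoss, frobeniusSq, inducedMatrix]

/-- Entrywise `x² + y² ≥ (x - y)² / 2`, over the `n - 1` columns other than `r`; the diagonal entry
is always `F 0`. -/
theorem le_rowLoss_add_rowLoss {F : ℝ → ℝ} {n : ℕ} (A : Matrix (Fin n) (Fin n) ℝ)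
    {w w' : Fin n → ℝ} {r : Fin n} {η : ℝ} (hη : 0 ≤ η)
    (h : ∀ j, r ≠ j → η ≤ |F (w r - w j) - F (w' r - w' j)|) :
    (n - 1) * (η ^ 2 / 2) ≤ rowLoss F A w r + rowLoss F A w' r := by
  have hcard : ((Finset.univ.erase r).card : ℝ) = n - 1 := by
    rw [Finset.card_erase_of_mem (Finset.mem_univ r), Finset.card_univ, Fintype.card_fin,
      Nat.cast_sub (by have := r.pos; omega), Nat.cast_one]
  unfold rowLoss
  rw [← hcard, ← nsmul_eq_mul, ← Finset.sum_add_distrib]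
  refine (Finset.card_nsmul_le_sum _
    (fun j => (A r j - F (w r - w j)) ^ 2 + (A r j - F (w' r - w' j)) ^ 2) _ fun j hj => ?_).trans
    (Finset.sum_le_sum_of_subset_of_nonneg (Finset.erase_subset _ _) fun _ _ _ => by positivity)
  have h1 := pow_le_pow_left₀ hη (h j (Finset.ne_of_mem_erase hj).symm) 2
  rw [sq_abs] at h1
  nlinarith [sq_nonneg ((A r j - F (w r - w j)) + (A r j - F (w' r - w' j)))]

theorem pairProb_mem_Icc {F : ℝ → ℝ} (hF : IsValidLink F) {n : ℕ} {w : Fin n → ℝ}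
    (hw : w ∈ weightSet n) (p : UpperPair n) :
    pairProb F w p ∈ Set.Icc (F (-2)) (1 - F (-2)) := by
  have h := sub_mem_Icc_of_mem_weightSet hw p.1.1 p.1.2
  rw [← hF.symm 2]
  exact ⟨hF.monotone h.1, hF.monotone h.2⟩

/-- Two weight vectors at a distance of order `n ^ (-1/2)` cannot be told apart. -/
theorem one_eighth_le_sum_min {F : ℝ → ℝ} (hF : IsValidLink F) (hmono : StrictMono F)
    (hd : Differentiable ℝ F) {B : ℝ} (hB : ∀ t ∈ Set.Icc (-2 : ℝ) 2, |linkScore F t| ≤ B)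
    {n : ℕ} {w w' : Fin n → ℝ} (hw : w ∈ weightSet n) (hw' : w' ∈ weightSet n)
    (h : B ^ 2 * (n * ∑ i, (w i - w' i) ^ 2) ≤ 2 * F (-2)) :
    1 / 8 ≤ ∑ Z : UpperPair n → Bool,
      min (bernoulliProd (pairProb F w) Z) (bernoulliProd (pairProb F w') Z) := by
  have hc := hF.pos hmono (-2)
  have hδ : ∑ i, (w i - w' i) = 0 := by rw [Finset.sum_sub_distrib, hw.1, hw'.1, sub_zero]
  have h1 : ∑ p : UpperPair n, (pairProb F w p - pairProb F w' p) ^ 2 ≤ 2 * F (-2) := by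
    refine le_trans ?_ h
    rw [← sum_upperPair_sub_sq hδ, Finset.mul_sum]
    refine Finset.sum_le_sum fun p _ => ?_
    have h2 := pow_le_pow_left₀ (abs_nonneg _) (abs_link_sub_le hF hmono hd hB
      (sub_mem_Icc_of_mem_weightSet hw p.1.1 p.1.2)
      (sub_mem_Icc_of_mem_weightSet hw' p.1.1 p.1.2)) 2
    rw [mul_pow, sq_abs, sq_abs] at h2
    refine h2.trans (le_of_eq ?_)
    ring
  have h2 := one_sub_le_affinity_bernoulliProd hc (pairProb_mem_Icc hF hw)
    (pairProb_mem_Icc hF hw')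
  have h3 : (∑ p : UpperPair n, (pairProb F w p - pairProb F w' p) ^ 2) / (4 * F (-2))
      ≤ 1 / 2 := by
    rw [div_le_iff₀ (by positivity)]
    linarith
  have h4 := sq_affinity_le_two_mul_sum_min
    (bernoulliProd_nonneg (q := pairProb F w) fun p => hF.mem_Icc _)
    (bernoulliProd_nonneg (q := pairProb F w') fun p => hF.mem_Icc _)
    (sum_bernoulliProd _) (sum_bernoulliProd _)
  nlinarith

theorem exists_weight_le_sum_loss {F : ℝ → ℝ} (hF : IsValidLink F) (hmono : StrictMono F)
    (hd : Differentiable ℝ F) {B : ℝ} (hB : ∀ t ∈ Set.Icc (-2 : ℝ) 2, |linkScore F t| ≤ B)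
    {τ : ℝ} (hτ : 0 < τ) (hexp : ∀ x ∈ Set.Icc (-1 : ℝ) 1, ∀ y ∈ Set.Icc (-1 : ℝ) 1,
      τ * |x - y| ≤ |F x - F y|) {n : ℕ} {ε : ℝ} (hε : 0 ≤ ε) (hε' : ε ≤ 1 / 2)
    (hsmall : B ^ 2 * (n * (8 * ε ^ 2)) ≤ 2 * F (-2))
    (A : (UpperPair n → Bool) → Matrix (Fin n) (Fin n) ℝ) :
    ∃ w ∈ weightSet n, ((n / 2 : ℕ) : ℝ) * ((n - 1) * (τ ^ 2 * ε ^ 2) / 8)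
      ≤ ∑ Z, bernoulliProd (pairProb F w) Z * frobeniusSq (A Z - inducedMatrix F w) := by
  -- Item `k` is paired with item `n / 2 + k`; for odd `n` the last item keeps weight 0.
  set a : Fin (n / 2) → Fin n := fun k => ⟨k, by omega⟩ with ha
  set b : Fin (n / 2) → Fin n := fun k => ⟨n / 2 + k, by omega⟩ with hb
  have ha' : Function.Injective a := fun k l h => by
    simp only [ha, Fin.mk.injEq] at h; omega
  have hb' : Function.Injective b := fun k l h => by
    simp only [hb, Fin.mk.injEq] at h; omega
  have hab : ∀ k l, a k ≠ b l := fun k l h => by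
    simp only [ha, hb, Fin.mk.injEq] at h; omega
  set W := cubeWeight a b ε with hW
  have hle : ∀ σ i, |W σ i| ≤ ε := abs_cubeWeight_le ha' hb' hab hε
  have hmem : ∀ σ, W σ ∈ weightSet n := fun σ =>
    ⟨sum_cubeWeight a b ε σ, fun i => (hle σ i).trans (by linarith)⟩
  have hmem1 : ∀ σ i j, W σ i - W σ j ∈ Set.Icc (-1 : ℝ) 1 := by
    intro σ i j
    have h1 := abs_le.1 (hle σ i)
    have h2 := abs_le.1 (hle σ j)
    exact ⟨by linarith, by linarith⟩
  have hnn : ∀ σ Z, 0 ≤ bernoulliProd (pairProb F (W σ)) Z := fun σ =>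
    bernoulliProd_nonneg fun p => hF.mem_Icc _
  obtain ⟨σ, hσ⟩ := exists_card_mul_le_sum_of_flipAt
    (G := fun k σ => ∑ Z, bernoulliProd (pairProb F (W σ)) Z * rowLoss F (A Z) (W σ) (a k))
    (L := (n - 1) * (τ ^ 2 * ε ^ 2) / 4) (by
      intro k σ
      have h1 : ∀ j, a k ≠ j → τ * (2 * ε)
          ≤ |F (W σ (a k) - W σ j) - F (W (flipAt k σ) (a k) - W (flipAt k σ) j)| :=
        fun j hj => (mul_le_mul_of_nonneg_left
          (two_mul_le_abs_cubeWeight_diff hab hε σ k hj) hτ.le).trans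
          (hexp _ (hmem1 σ _ _) _ (hmem1 _ _ _))
      have h2 := mul_sum_min_le (hnn σ) (hnn (flipAt k σ))
        (fun Z => rowLoss_nonneg F (A Z) (W σ) (a k))
        (fun Z => rowLoss_nonneg F (A Z) (W (flipAt k σ)) (a k))
        fun Z => le_rowLoss_add_rowLoss (A Z) (by positivity) h1
      refine le_trans ?_ h2
      have h3 := one_eighth_le_sum_min hF hmono hd hB (hmem σ) (hmem (flipAt k σ))
        (by rw [hW, sum_cubeWeight_sub_flipAt_sq hab]; exact hsmall)
      have h4 : (1 : ℝ) ≤ n := by exact_mod_cast (a k).pos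
      have h5 : 0 ≤ ((n : ℝ) - 1) * ((τ * (2 * ε)) ^ 2 / 2) :=
        mul_nonneg (by linarith) (by positivity)
      refine le_trans (le_of_eq ?_) (mul_le_mul_of_nonneg_left h3 h5)
      ring)
  refine ⟨W σ, hmem σ, ?_⟩
  rw [Fintype.card_fin] at hσ
  refine le_trans (le_of_eq (by ring)) (hσ.trans ?_)
  rw [Finset.sum_comm]
  refine Finset.sum_le_sum fun Z _ => ?_
  rw [← Finset.mul_sum, ← sum_rowLoss]
  refine mul_le_mul_of_nonneg_left ?_ (hnn σ Z)
  -- The rows `a k` are distinct, so their losses add up to at most the full Frobenius loss.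
  rw [← Finset.sum_image (f := rowLoss F (A Z) (W σ)) fun k _ l _ h => ha' h]
  exact Finset.sum_le_univ_sum_of_nonneg fun r => rowLoss_nonneg F _ _ r

theorem le_minimaxRisk_parametricClass {F : ℝ → ℝ} (hF : IsValidLink F) (hmono : StrictMono F)
    (hd : Differentiable ℝ F) {B : ℝ} (hB1 : 1 ≤ B)
    (hB : ∀ t ∈ Set.Icc (-2 : ℝ) 2, |linkScore F t| ≤ B)
    {τ : ℝ} (hτ : 0 < τ) (hexp : ∀ x ∈ Set.Icc (-1 : ℝ) 1, ∀ y ∈ Set.Icc (-1 : ℝ) 1,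
      τ * |x - y| ≤ |F x - F y|) {n : ℕ} (hn : 2 ≤ n) :
    ENNReal.ofReal (τ ^ 2 * F (-2) / (256 * B ^ 2) / n) ≤ minimaxRisk (parametricClass F n) := by
  have hn2 : (2 : ℝ) ≤ n := by exact_mod_cast hn
  have hc := hF.pos hmono (-2)
  have hc1 := (hF.mem_Icc (-2)).2
  have hBn : 2 ≤ B ^ 2 * n := by nlinarith
  -- This choice makes the indistinguishability condition `B² n · 8ε² ≤ 2 F (-2)` an equality.
  set ε := √(F (-2) / (4 * (B ^ 2 * n))) with hεdef
  have hε2 : ε ^ 2 = F (-2) / (4 * (B ^ 2 * n)) := Real.sq_sqrt (by positivity)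
  have hε : 0 ≤ ε := Real.sqrt_nonneg _
  have hε' : ε ≤ 1 / 2 := by
    refine abs_le_of_sq_le_sq' ?_ (by norm_num) |>.2
    rw [hε2, div_le_iff₀ (by positivity)]
    linarith
  refine le_iInf₂ fun Mhat _ => ?_
  obtain ⟨w, hw, hloss⟩ := exists_weight_le_sum_loss hF hmono hd hB hτ hexp (n := n) hε hε'
    (by rw [hε2]; refine le_of_eq ?_; field_simp; ring) fun Z => Mhat (completeObservation Z)
  refine le_trans ?_ (le_iSup₂ (f := fun M _ => risk Mhat M) (inducedMatrix F w) ⟨w, hw, rfl⟩)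
  rw [risk_inducedMatrix hF]
  refine ENNReal.ofReal_le_ofReal ?_
  have e : ∑ Z : UpperPair n → Bool, bernoulliProd (pairProb F w) Z * (1 / (n : ℝ) ^ 2 *
        frobeniusSq (Mhat (completeObservation Z) - inducedMatrix F w))
      = 1 / (n : ℝ) ^ 2 * ∑ Z : UpperPair n → Bool, bernoulliProd (pairProb F w) Z *
        frobeniusSq (Mhat (completeObservation Z) - inducedMatrix F w) := by
    rw [Finset.mul_sum]
    exact Finset.sum_congr rfl fun Z _ => by ring
  rw [e]
  -- Halving `n / 2` absorbs the floor for `n ≥ 2`; likewise `n - 1 ≥ n / 2` below.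
  have hm : (n : ℝ) / 4 ≤ ((n / 2 : ℕ) : ℝ) := by
    have h1 : n ≤ 4 * (n / 2) := by omega
    have h2 : (n : ℝ) ≤ 4 * ((n / 2 : ℕ) : ℝ) := by exact_mod_cast h1
    linarith
  calc τ ^ 2 * F (-2) / (256 * B ^ 2) / n
      = 1 / (n : ℝ) ^ 2 * ((n : ℝ) / 4 * ((n / 2 : ℝ) * (τ ^ 2 * ε ^ 2) / 8)) := by
        rw [hε2]; field_simp; ring
    _ ≤ 1 / (n : ℝ) ^ 2 * (((n / 2 : ℕ) : ℝ) * ((n - 1) * (τ ^ 2 * ε ^ 2) / 8)) := by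
        gcongr
        linarith
    _ ≤ _ := mul_le_mul_of_nonneg_left hloss (by positivity)

theorem theorem4 (F : ℝ → ℝ) (hvalid : IsValidLink F) (hmono : StrictMono F)
    (hconc : IsStronglyLogConcave F) (hdiff : IsTwiceDifferentiable F) :
    ∃ cl : ℝ, 0 < cl ∧
      (∀ n : ℕ, 2 ≤ n → ENNReal.ofReal (cl / n) ≤ minimaxRisk (parametricClass F n)) ∧
      ∃ cu : ℝ, cl ≤ cu ∧
        ∀ n : ℕ, 2 ≤ n →
          (∀ Y : Observation n, ∃! w : Fin n → ℝ, IsMLE F Y w) ∧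
          ∀ what : Observation n → Fin n → ℝ, (∀ Y, IsMLE F Y (what Y)) →
            (⨆ M ∈ parametricClass F n, risk (fun Y => inducedMatrix F (what Y)) M)
              ≤ ENNReal.ofReal (cu / n) := by
  have hd := hdiff.1
  obtain ⟨B, hB1, hB⟩ := exists_linkScore_bound hvalid hmono hdiff
  obtain ⟨τ, hτ, hexp⟩ := exists_link_expansion hvalid hmono hconc hd
  obtain ⟨γ, hγ, hc⟩ := id hconc
  have hpos := hvalid.pos hmono (-2)
  refine ⟨τ ^ 2 * F (-2) / (256 * B ^ 2), by positivity,
    fun n hn => le_minimaxRisk_parametricClass hvalid hmono hd hB1 hB hτ hexp hn,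
    max (τ ^ 2 * F (-2) / (256 * B ^ 2)) (16 * B ^ 4 / γ ^ 2), le_max_left _ _,
    fun n hn => ⟨fun Y => ?_, fun what hwhat => iSup₂_le ?_⟩⟩
  · obtain ⟨w, hw⟩ := exists_isMLE hd Y
    exact ⟨w, hw, fun v hv => hv.unique hvalid hmono hconc hd hw⟩
  · rintro _ ⟨w, hw, rfl⟩
    refine (risk_mle_le hvalid hmono hd hγ hc hB (by omega) hwhat hw).trans
      (ENNReal.ofReal_le_ofReal ?_)
    gcongr
    exact le_max_right _ _
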